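/- Let $d\ge 1$, $0<s<1$, let $\Omega\subset\mathbb{R}^d$ be open and bounded, and let $0<g_*\le g^*$. Let $g:\mathbb{R}^d\times\mathbb{R}^d\times(0,\infty)\to\mathbb{R}$ be measurable and such that, for almost every $(x,y)\in\mathbb{R}^d\times\mathbb{R}^d$, and also at $(x,x)$ for almost every $x\in\mathbb{R}^d$, the function $r\mapsto g(x,y,r)$ is positive and locally Lipschitz on $(0,\infty)$, $\lim_{r\to0^+}r\,g(x,y,r)=0$, $\lim_{r\to+\infty}r\,g(x,y,r)=+\infty$, and $$g_*\le \frac{r\,\partial_r g(x,y,r)}{g(x,y,r)}+1\le g^*\qquad\text{for a.e. } r>0 .$$ Put $G(x,y,r)=\int_0^r g(x,y,\rho)\rho\,d\rho$ and $\delta^su(x,y)=\frac{u(x)-u(y)}{|x-y|^s}$. For measurable $u:\mathbb{R}^d\to\mathbb{R}$ let $$\Gamma_{\hat G}(u)=\int_{\mathbb{R}^d}G(x,x,|u(x)|)\,dx,\qquad \Gamma_{s,G}(u)=\int_{\mathbb{R}^d}\int_{\mathbb{R}^d}G(x,y,|\delta^su(x,y)|)\frac{dx\,dy}{|x-y|^d},$$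 let $W^{s,G}(\mathbb{R}^d)$ be the space of those $u$ for which both are finite, with the norm $\|u\|_{s,G}=\inf\{\lambda>0:\Gamma_{\hat G}(u/\lambda)\le1\}+\inf\{\lambda>0:\Gamma_{s,G}(u/\lambda)\le1\}$, and let $W^{s,G}_0(\Omega)$ be the closure in it of $C_c^\infty(\Omega)\cap W^{s,G}(\mathbb{R}^d)$, its elements being functions on $\mathbb{R}^d$ that vanish a.e. outside $\Omega$. Let $[W^{s,G}_0(\Omega)]^*$ be the dual space, where $F\ge\hat F$ means that $\langle F-\hat F,v\rangle\ge0$ for every $v\in W^{s,G}_0(\Omega)$ with $v\ge0$ a.e. For $u,v\in W^{s,G}_0(\Omega)$ let $$\langle\mathcal{L}_g^su,v\rangle=\int_{\mathbb{R}^d}\int_{\mathbb{R}^d}g(x,y,|\delta^su(x,y)|)\,\delta^su(x,y)\,\delta^sv(x,y)\,\frac{dx\,dy}{|x-y|^d}.$$ Let $F,\hat F\in[W^{s,G}_0(\Omega)]^*$, and let $u,\hat u\in W^{s,G}_0(\Omega)$ be the solutions of the Dirichlet problems for $\mathcal{L}_g^su=F$ and $\mathcal{L}_g^s\hat u=\hat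 F$, that is, $\langle\mathcal{L}_g^su,v\rangle=\langle F,v\rangle$ and $\langle\mathcal{L}_g^s\hat u,v\rangle=\langle\hat F,v\rangle$ for all $v\in W^{s,G}_0(\Omega)$. If $F\ge\hat F$, then $u\ge\hat u$ a.e. in $\Omega$. -/

import Mathlib

open MeasureTheory Set Filter Topology
open scoped ENNReal NNReal

noncomputable section

namespace FracOrlicz

/-- The structural conditions on `r ↦ g(x, y, r)`, `r > 0`, for one fixed pair `(x, y)`.
A locally Lipschitz function is differentiable at almost every `r > 0`, so the two-sided growth
bound is imposed at almost every `r > 0`. -/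
structure IsProfile (gl gu : ℝ) (h : ℝ → ℝ) : Prop where
  pos : ∀ r : ℝ, 0 < r → 0 < h r
  locLipschitz : LocallyLipschitzOn (Ioi (0 : ℝ)) h
  tendsto_zero : Tendsto (fun r : ℝ => r * h r) (𝓝[>] (0 : ℝ)) (𝓝 0)
  tendsto_atTop : Tendsto (fun r : ℝ => r * h r) atTop atTop
  growth : ∀ᵐ r : ℝ, 0 < r → gl ≤ r * deriv h r / h r + 1 ∧ r * deriv h r / h r + 1 ≤ gu

/-- The nonlinearity `g(x, y, r)`, with growth constants `0 < gl ≤ gu`. Only its values at `r > 0`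
matter. The profile conditions hold for almost every pair `(x, y)`, and also at almost every
diagonal pair `(x, x)` (the diagonal is a null set, but `G(x, x, r)` enters the function space). -/
structure IsNonlinearity {d : ℕ} (gl gu : ℝ)
    (g : EuclideanSpace ℝ (Fin d) → EuclideanSpace ℝ (Fin d) → ℝ → ℝ) : Prop where
  gl_pos : 0 < gl
  gl_le_gu : gl ≤ gu
  measurable : Measurable
    (fun p : EuclideanSpace ℝ (Fin d) × EuclideanSpace ℝ (Fin d) × ℝ => g p.1 p.2.1 p.2.2)
  profile : ∀ᵐ p : EuclideanSpace ℝ (Fin d) × EuclideanSpace ℝ (Fin d),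
    IsProfile gl gu (g p.1 p.2)
  profile_diag : ∀ᵐ x : EuclideanSpace ℝ (Fin d), IsProfile gl gu (g x x)

/-- The primitive `G(x, y, r) = ∫₀ʳ g(x, y, ρ) ρ dρ`. -/
def primitive {d : ℕ} (g : EuclideanSpace ℝ (Fin d) → EuclideanSpace ℝ (Fin d) → ℝ → ℝ)
    (x y : EuclideanSpace ℝ (Fin d)) (r : ℝ) : ℝ :=
  ∫ ρ in (0 : ℝ)..r, g x y ρ * ρ

/-- The two-point difference quotient `δˢu(x, y) = (u(x) - u(y)) / |x - y|ˢ`. -/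
def diffQuot {d : ℕ} (s : ℝ) (u : EuclideanSpace ℝ (Fin d) → ℝ)
    (x y : EuclideanSpace ℝ (Fin d)) : ℝ :=
  (u x - u y) / ‖x - y‖ ^ s

/-- The modular `∫ G(x, x, |u(x)|) dx`. -/
def modular {d : ℕ} (g : EuclideanSpace ℝ (Fin d) → EuclideanSpace ℝ (Fin d) → ℝ → ℝ)
    (u : EuclideanSpace ℝ (Fin d) → ℝ) : ℝ≥0∞ :=
  ∫⁻ x : EuclideanSpace ℝ (Fin d), ENNReal.ofReal (primitive g x x |u x|)

/-- The fractional modular `∬ G(x, y, |δˢu(x, y)|) dx dy / |x - y|ᵈ`. -/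
def fracModular {d : ℕ} (g : EuclideanSpace ℝ (Fin d) → EuclideanSpace ℝ (Fin d) → ℝ → ℝ)
    (s : ℝ) (u : EuclideanSpace ℝ (Fin d) → ℝ) : ℝ≥0∞ :=
  ∫⁻ p : EuclideanSpace ℝ (Fin d) × EuclideanSpace ℝ (Fin d),
    ENNReal.ofReal (primitive g p.1 p.2 |diffQuot s u p.1 p.2| / ‖p.1 - p.2‖ ^ d)

/-- The Luxemburg functional `inf {t > 0 : Γ(u / t) ≤ 1}` of a modular `Γ`, with value `∞` if there
is no such `t`. -/
def luxemburg {d : ℕ} (Γ : (EuclideanSpace ℝ (Fin d) → ℝ) → ℝ≥0∞)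
    (u : EuclideanSpace ℝ (Fin d) → ℝ) : ℝ≥0∞ :=
  ⨅ (t : ℝ) (_ : 0 < t ∧ Γ (fun x => u x / t) ≤ 1), ENNReal.ofReal t

/-- The norm `‖u‖_{s,G} = ‖u‖_G + [u]_{s,G}`. -/
def normW {d : ℕ} (g : EuclideanSpace ℝ (Fin d) → EuclideanSpace ℝ (Fin d) → ℝ → ℝ)
    (s : ℝ) (u : EuclideanSpace ℝ (Fin d) → ℝ) : ℝ≥0∞ :=
  luxemburg (modular g) u + luxemburg (fracModular g s) u

/-- Membership in `W^{s,G}(ℝᵈ)`. -/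
structure MemW {d : ℕ} (g : EuclideanSpace ℝ (Fin d) → EuclideanSpace ℝ (Fin d) → ℝ → ℝ)
    (s : ℝ) (u : EuclideanSpace ℝ (Fin d) → ℝ) : Prop where
  aemeasurable : AEMeasurable u
  modular_lt_top : modular g u < ∞
  fracModular_lt_top : fracModular g s u < ∞

/-- Membership in `C_c^∞(Ω)`, the functions being extended by zero to `ℝᵈ`. -/
structure IsTest {d : ℕ} (Ω : Set (EuclideanSpace ℝ (Fin d)))
    (φ : EuclideanSpace ℝ (Fin d) → ℝ) : Prop where
  contDiff : ContDiff ℝ ((⊤ : ℕ∞) : WithTop ℕ∞) φ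
  hasCompactSupport : HasCompactSupport φ
  tsupport_subset : tsupport φ ⊆ Ω

/-- Membership in `W₀^{s,G}(Ω)`, the closure of `C_c^∞(Ω)` in the norm of `W^{s,G}(ℝᵈ)`; its
elements are regarded as functions on `ℝᵈ` that vanish outside `Ω`. -/
structure MemW0 {d : ℕ} (g : EuclideanSpace ℝ (Fin d) → EuclideanSpace ℝ (Fin d) → ℝ → ℝ)
    (s : ℝ) (Ω : Set (EuclideanSpace ℝ (Fin d))) (u : EuclideanSpace ℝ (Fin d) → ℝ) : Prop where
  memW : MemW g s u
  ae_zero : ∀ᵐ x : EuclideanSpace ℝ (Fin d), x ∉ Ω → u x = 0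
  approx : ∀ ε : ℝ≥0∞, 0 < ε → ∃ φ : EuclideanSpace ℝ (Fin d) → ℝ,
    IsTest Ω φ ∧ normW g s (fun x => u x - φ x) < ε

/-- `F` is an element of the dual space `W^{-s,G*}(Ω) = [W₀^{s,G}(Ω)]*`: a linear functional on
`W₀^{s,G}(Ω)`, bounded with respect to the norm. The values of `F` outside `W₀^{s,G}(Ω)` are
irrelevant. -/
structure IsDual {d : ℕ} (g : EuclideanSpace ℝ (Fin d) → EuclideanSpace ℝ (Fin d) → ℝ → ℝ)
    (s : ℝ) (Ω : Set (EuclideanSpace ℝ (Fin d)))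
    (F : (EuclideanSpace ℝ (Fin d) → ℝ) → ℝ) : Prop where
  map_add : ∀ u v : EuclideanSpace ℝ (Fin d) → ℝ, MemW0 g s Ω u → MemW0 g s Ω v →
    F (fun x => u x + v x) = F u + F v
  map_smul : ∀ (c : ℝ) (u : EuclideanSpace ℝ (Fin d) → ℝ), MemW0 g s Ω u →
    F (fun x => c * u x) = c * F u
  bounded : ∃ C : ℝ≥0, ∀ u : EuclideanSpace ℝ (Fin d) → ℝ, MemW0 g s Ω u →
    ENNReal.ofReal |F u| ≤ C * normW g s u

/-- The order `F̂ ≤ F` of the dual space: `⟨F - F̂, v⟩ ≥ 0` for all `v ≥ 0` in `W₀^{s,G}(Ω)`. -/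
def DualLE {d : ℕ} (g : EuclideanSpace ℝ (Fin d) → EuclideanSpace ℝ (Fin d) → ℝ → ℝ)
    (s : ℝ) (Ω : Set (EuclideanSpace ℝ (Fin d)))
    (F' F : (EuclideanSpace ℝ (Fin d) → ℝ) → ℝ) : Prop :=
  ∀ v : EuclideanSpace ℝ (Fin d) → ℝ, MemW0 g s Ω v → (∀ᵐ x, 0 ≤ v x) → 0 ≤ F v - F' v

/-- The pairing `⟨ℒ_g^s u, v⟩ = ∬ g(x, y, |δˢu|) δˢu δˢv dx dy / |x - y|ᵈ`. -/
def operatorPairing {d : ℕ} (g : EuclideanSpace ℝ (Fin d) → EuclideanSpace ℝ (Fin d) → ℝ → ℝ)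
    (s : ℝ) (u v : EuclideanSpace ℝ (Fin d) → ℝ) : ℝ :=
  ∫ p : EuclideanSpace ℝ (Fin d) × EuclideanSpace ℝ (Fin d),
    g p.1 p.2 |diffQuot s u p.1 p.2| * diffQuot s u p.1 p.2 * diffQuot s v p.1 p.2
      / ‖p.1 - p.2‖ ^ d

/-- `u` is the variational solution of the Dirichlet problem `ℒ_g^s u = F` in `Ω`, `u = 0` outside
`Ω`. -/
structure IsSolution {d : ℕ} (g : EuclideanSpace ℝ (Fin d) → EuclideanSpace ℝ (Fin d) → ℝ → ℝ)
    (s : ℝ) (Ω : Set (EuclideanSpace ℝ (Fin d)))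
    (F : (EuclideanSpace ℝ (Fin d) → ℝ) → ℝ) (u : EuclideanSpace ℝ (Fin d) → ℝ) : Prop where
  memW0 : MemW0 g s Ω u
  eq : ∀ v : EuclideanSpace ℝ (Fin d) → ℝ, MemW0 g s Ω v → operatorPairing g s u v = F v

end FracOrlicz

end

/-! Both equations are tested with `w = (u' - u)⁺`. The order of the data gives `⟨ℒu', w⟩ ≤ ⟨ℒu,
w⟩`. Conversely, `t ↦ g(x, y, |t|) t` is strictly increasing, and an increment of `w` never has the
sign opposite to that of `u' - u`, so the integrands satisfy the reverse inequality pointwise. Hence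
they agree almost everywhere. Strict monotonicity then forces `w(x) = w(y)` for almost every pair,
so `w` is a.e. constant; it vanishes outside the bounded set `Ω`, hence `w = 0`.

The main work is to show that `w` is an admissible test function (`MemW0.posPart_sub`). The lower
growth bound gives the strict monotonicity (`IsProfile.strictMono_field`), while the upper one gives
a doubling inequality for the primitive (`IsProfile.prim_scale`). Doubling makes convergence to zero
in modular imply convergence in the Luxemburg norm. It thus suffices to approximate `w` in modular
by smoothed positive parts of test functions; `tendsto_familyModular_zero`, a dominated convergence
theorem with a varying majorant, does this. Doubling also replaces Young's inequality in the
integrability of the pairings. -/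

namespace FracOrlicz

/-! ### One-variable estimates: growth of a profile, doubling of its primitive, monotone field. -/

namespace IsProfile

variable {gl gu : ℝ} {h : ℝ → ℝ}

theorem absolutelyContinuousOnInterval (H : IsProfile gl gu h) {a b : ℝ} (ha : 0 < a)
    (hab : a ≤ b) : AbsolutelyContinuousOnInterval h a b := by
  have hsub : uIcc a b ⊆ Ioi (0 : ℝ) := by
    rw [uIcc_of_le hab]
    exact fun x hx => lt_of_lt_of_le ha hx.1
  obtain ⟨K, hK⟩ := (H.locLipschitz.mono hsub).exists_lipschitzOnWith_of_compact
    isCompact_uIcc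
  exact hK.absolutelyContinuousOnInterval

theorem absolutelyContinuousOnInterval_rpow (q : ℝ) {a b : ℝ} (ha : 0 < a) (hab : a ≤ b) :
    AbsolutelyContinuousOnInterval (fun r : ℝ => r ^ q) a b := by
  apply ContDiffOn.absolutelyContinuousOnInterval
  intro x hx
  rw [uIcc_of_le hab] at hx
  exact (Real.contDiffAt_rpow_const_of_ne (lt_of_lt_of_le ha hx.1).ne').contDiffWithinAt

/-- The lower growth bound says that the a.e. derivative `r ^ (-gl) * (r h' + (1 - gl) h)` is
nonnegative. Both factors are absolutely continuous on compact subintervals of `(0, ∞)`, so this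
sign can be integrated. -/
theorem monotoneOn_mul_rpow (H : IsProfile gl gu h) :
    MonotoneOn (fun r => h r * r ^ (1 - gl)) (Ioi 0) := by
  intro a ha b _ hab
  have ha : 0 < a := ha
  have key := AbsolutelyContinuousOnInterval.integral_deriv_mul_eq_sub
    (H.absolutelyContinuousOnInterval ha hab)
    (absolutelyContinuousOnInterval_rpow (1 - gl) ha hab)
  have hnn : 0 ≤ ∫ x in a..b, deriv h x * x ^ (1 - gl)
      + h x * deriv (fun r : ℝ => r ^ (1 - gl)) x := by
    apply intervalIntegral.integral_nonneg_of_ae_restrict hab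
    filter_upwards [ae_restrict_of_ae H.growth, ae_restrict_mem measurableSet_Icc] with x hx hxab
    have hx0 : 0 < x := lt_of_lt_of_le ha hxab.1
    have hh := H.pos x hx0
    have h1 := (hx hx0).1
    rw [Real.deriv_rpow_const]
    have h2 : x ^ (1 - gl) = x ^ (1 - gl - 1) * x := by
      rw [← Real.rpow_add_one hx0.ne']; ring_nf
    rw [h2]
    have h3 : (gl - 1) * h x ≤ x * deriv h x := by
      rw [← le_div_iff₀ hh]; linarith
    have h4 : 0 ≤ x ^ (1 - gl - 1) := Real.rpow_nonneg hx0.le _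
    have := mul_nonneg h4 (sub_nonneg.2 h3)
    simp only [Pi.zero_apply]
    linarith
  simp only
  linarith

theorem antitoneOn_mul_rpow (H : IsProfile gl gu h) :
    AntitoneOn (fun r => h r * r ^ (1 - gu)) (Ioi 0) := by
  intro a ha b _ hab
  have ha : 0 < a := ha
  have key := AbsolutelyContinuousOnInterval.integral_deriv_mul_eq_sub
    (H.absolutelyContinuousOnInterval ha hab)
    (absolutelyContinuousOnInterval_rpow (1 - gu) ha hab)
  have hnn : 0 ≤ ∫ x in a..b, -(deriv h x * x ^ (1 - gu)
      + h x * deriv (fun r : ℝ => r ^ (1 - gu)) x) := by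
    apply intervalIntegral.integral_nonneg_of_ae_restrict hab
    filter_upwards [ae_restrict_of_ae H.growth, ae_restrict_mem measurableSet_Icc] with x hx hxab
    have hx0 : 0 < x := lt_of_lt_of_le ha hxab.1
    have hh := H.pos x hx0
    have h1 := (hx hx0).2
    rw [Real.deriv_rpow_const]
    have h2 : x ^ (1 - gu) = x ^ (1 - gu - 1) * x := by
      rw [← Real.rpow_add_one hx0.ne']; ring_nf
    rw [h2]
    have h3 : x * deriv h x ≤ (gu - 1) * h x := by
      rw [← div_le_iff₀ hh]; linarith
    have h4 : 0 ≤ x ^ (1 - gu - 1) := Real.rpow_nonneg hx0.le _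
    have := mul_nonneg h4 (sub_nonneg.2 h3)
    simp only [Pi.zero_apply]
    linarith
  rw [intervalIntegral.integral_neg] at hnn
  simp only
  linarith

/-- For `r > 0`, `h r * r` is the positive nondecreasing factor `h r * r ^ (1 - gl)` times the
strictly increasing `r ^ gl`. The endpoint `0` may be included because the product vanishes there
whatever `h 0` is. -/
theorem strictMonoOn_mul_self (H : IsProfile gl gu h) (hgl : 0 < gl) :
    StrictMonoOn (fun r => h r * r) (Ici 0) := by
  intro a ha b _ hab
  have hb : 0 < b := lt_of_le_of_lt ha hab
  rcases eq_or_lt_of_le (show 0 ≤ a from ha) with rfl | ha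
  · simpa using mul_pos (H.pos b hb) hb
  · have h1 := H.monotoneOn_mul_rpow ha hb hab.le
    have e : ∀ r : ℝ, 0 < r → h r * r = h r * r ^ (1 - gl) * r ^ gl := fun r hr => by
      rw [mul_assoc, ← Real.rpow_add hr]; simp
    simp only at h1 ⊢
    rw [e a ha, e b hb]
    have h2 : a ^ gl < b ^ gl := Real.rpow_lt_rpow ha.le hab hgl
    have h3 : 0 < h b * b ^ (1 - gl) := mul_pos (H.pos b hb) (Real.rpow_pos_of_pos hb _)
    calc h a * a ^ (1 - gl) * a ^ gl ≤ h b * b ^ (1 - gl) * a ^ gl := by gcongr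
      _ < _ := by gcongr

theorem mul_self_nonneg (H : IsProfile gl gu h) {r : ℝ} (hr : 0 ≤ r) : 0 ≤ h r * r := by
  rcases eq_or_lt_of_le hr with rfl | hr
  · simp
  · exact (mul_pos (H.pos r hr) hr).le

theorem mul_self_scale_le (H : IsProfile gl gu h) {c r : ℝ} (hc : 1 ≤ c) (hr : 0 ≤ r) :
    h (c * r) * (c * r) ≤ c ^ gu * (h r * r) := by
  rcases eq_or_lt_of_le hr with rfl | hr
  · simp
  have hc0 : 0 < c := by linarith
  have hcr : 0 < c * r := mul_pos hc0 hr
  have h1 := H.antitoneOn_mul_rpow hr hcr (le_mul_of_one_le_left hr.le hc)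
  have e : ∀ r : ℝ, 0 < r → h r * r = h r * r ^ (1 - gu) * r ^ gu := fun r hr => by
    rw [mul_assoc, ← Real.rpow_add hr]; simp
  simp only at h1
  rw [e _ hcr, e r hr, Real.mul_rpow hc0.le hr.le (z := gu)]
  have : 0 ≤ c ^ gu * r ^ gu := by positivity
  nlinarith

end IsProfile

/-- The primitive `∫₀ʳ h(ρ) ρ dρ` of a single profile. -/
noncomputable def prim (h : ℝ → ℝ) (r : ℝ) : ℝ := ∫ ρ in (0 : ℝ)..r, h ρ * ρ

namespace IsProfile

variable {gl gu : ℝ} {h : ℝ → ℝ}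

theorem intervalIntegrable (H : IsProfile gl gu h) (hgl : 0 < gl) {a b : ℝ} (ha : 0 ≤ a)
    (hb : 0 ≤ b) : IntervalIntegrable (fun ρ => h ρ * ρ) volume a b :=
  ((H.strictMonoOn_mul_self hgl).monotoneOn.mono fun _ hx =>
    le_trans (le_min ha hb) hx.1).intervalIntegrable

theorem prim_mono (H : IsProfile gl gu h) (hgl : 0 < gl) {a b : ℝ} (ha : 0 ≤ a) (hab : a ≤ b) :
    prim h a ≤ prim h b := by
  have hb := ha.trans hab
  have := intervalIntegral.integral_add_adjacent_intervals
    (H.intervalIntegrable hgl le_rfl ha) (H.intervalIntegrable hgl ha hb)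
  have h2 : 0 ≤ ∫ ρ in a..b, h ρ * ρ := intervalIntegral.integral_nonneg hab
    fun x hx => H.mul_self_nonneg (ha.trans hx.1)
  unfold prim
  linarith

theorem prim_nonneg (H : IsProfile gl gu h) (hgl : 0 < gl) {a : ℝ} (ha : 0 ≤ a) :
    0 ≤ prim h a := by
  simpa [prim] using H.prim_mono hgl le_rfl ha

theorem prim_mul (c r : ℝ) :
    prim h (c * r) = c * ∫ ρ in (0 : ℝ)..r, h (c * ρ) * (c * ρ) := by
  have := intervalIntegral.mul_integral_comp_mul_left (f := fun ρ => h ρ * ρ) (a := 0) (b := r) c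
  rw [mul_zero] at this
  exact this.symm

theorem intervalIntegrable_comp (H : IsProfile gl gu h) (hgl : 0 < gl) {c r : ℝ} (hc : 0 ≤ c)
    (hr : 0 ≤ r) : IntervalIntegrable (fun ρ => h (c * ρ) * (c * ρ)) volume 0 r := by
  apply MonotoneOn.intervalIntegrable
  rw [uIcc_of_le hr]
  intro x hx y hy hxy
  exact (H.strictMonoOn_mul_self hgl).monotoneOn (mul_nonneg hc hx.1) (mul_nonneg hc hy.1)
    (mul_le_mul_of_nonneg_left hxy hc)

theorem prim_contract (H : IsProfile gl gu h) (hgl : 0 < gl) {t r : ℝ} (ht : 0 ≤ t) (ht1 : t ≤ 1)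
    (hr : 0 ≤ r) : prim h (t * r) ≤ t * prim h r := by
  rw [prim_mul]
  refine mul_le_mul_of_nonneg_left ?_ ht
  refine intervalIntegral.integral_mono_on hr (H.intervalIntegrable_comp hgl ht hr)
    (H.intervalIntegrable hgl le_rfl hr) fun x hx => ?_
  exact (H.strictMonoOn_mul_self hgl).monotoneOn (mul_nonneg ht hx.1) hx.1
    (mul_le_of_le_one_left hx.1 ht1)

/-- The doubling condition. Its case `c = 2` is the source of the constant `2 * 2 ^ gu` everywhere
below. -/
theorem prim_scale (H : IsProfile gl gu h) (hgl : 0 < gl) {c r : ℝ} (hc : 1 ≤ c)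
    (hr : 0 ≤ r) : prim h (c * r) ≤ c * c ^ gu * prim h r := by
  have hc0 : 0 ≤ c := by linarith
  rw [prim_mul, mul_assoc]
  refine mul_le_mul_of_nonneg_left ?_ hc0
  rw [prim, ← intervalIntegral.integral_const_mul]
  exact intervalIntegral.integral_mono_on hr (H.intervalIntegrable_comp hgl hc0 hr)
    ((H.intervalIntegrable hgl le_rfl hr).const_mul _) fun x hx => H.mul_self_scale_le hc hx.1

theorem prim_add_le (H : IsProfile gl gu h) (hgl : 0 < gl) {a b : ℝ} (ha : 0 ≤ a) (hb : 0 ≤ b) :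
    prim h (a + b) ≤ 2 * 2 ^ gu * (prim h a + prim h b) := by
  have hK : (0 : ℝ) ≤ 2 * 2 ^ gu := by positivity
  have hm : 0 ≤ max a b := le_max_of_le_left ha
  calc prim h (a + b) ≤ prim h (2 * max a b) :=
        H.prim_mono hgl (by positivity) (by linarith [le_max_left a b, le_max_right a b])
    _ ≤ 2 * 2 ^ gu * prim h (max a b) := H.prim_scale hgl one_le_two hm
    _ ≤ _ := by
      refine mul_le_mul_of_nonneg_left ?_ hK
      have h1 := H.prim_nonneg hgl ha
      have h2 := H.prim_nonneg hgl hb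
      rcases max_choice a b with e | e <;> rw [e] <;> linarith

/-- On `[r, 2r]` the integrand is at least its value at `r`, so the left side is at most `prim h (2
* r)`, and doubling applies. -/
theorem mul_sq_le_prim (H : IsProfile gl gu h) (hgl : 0 < gl) {r : ℝ} (hr : 0 ≤ r) :
    h r * r * r ≤ 2 * 2 ^ gu * prim h r := by
  refine le_trans ?_ (H.prim_scale hgl one_le_two hr)
  have h2r : 0 ≤ 2 * r := by linarith
  have h1 := intervalIntegral.integral_add_adjacent_intervals
    (H.intervalIntegrable hgl le_rfl hr) (H.intervalIntegrable hgl hr h2r)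
  have h2 : ∫ _ in r..(2 * r), h r * r ≤ ∫ ρ in r..(2 * r), h ρ * ρ :=
    intervalIntegral.integral_mono_on (by linarith) (by simp) (H.intervalIntegrable hgl hr h2r)
      fun x hx => (H.strictMonoOn_mul_self hgl).monotoneOn hr (hr.trans hx.1) hx.1
  have h3 := H.prim_nonneg hgl hr
  rw [intervalIntegral.integral_const, smul_eq_mul] at h2
  unfold prim at h3 ⊢
  linarith

theorem prim_pos (H : IsProfile gl gu h) (hgl : 0 < gl) {r : ℝ} (hr : 0 < r) :
    0 < prim h r := by
  have h1 := H.mul_sq_le_prim hgl hr.le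
  have h2 : 0 < h r * r * r := mul_pos (mul_pos (H.pos r hr) hr) hr
  have hK : (0 : ℝ) < 2 * 2 ^ gu := by positivity
  exact pos_of_mul_pos_right (h2.trans_le h1) hK.le

/-- A substitute for Young's inequality without the conjugate function: replace the smaller of `a`,
`b` by the larger and use `mul_sq_le_prim`. -/
theorem mul_mul_le_prim (H : IsProfile gl gu h) (hgl : 0 < gl) {a b : ℝ} (ha : 0 ≤ a)
    (hb : 0 ≤ b) : h a * a * b ≤ 2 * 2 ^ gu * (prim h a + prim h b) := by
  have hK : (0 : ℝ) ≤ 2 * 2 ^ gu := by positivity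
  have h1 := mul_nonneg hK (H.prim_nonneg hgl ha)
  have h2 := mul_nonneg hK (H.prim_nonneg hgl hb)
  rcases le_total b a with hba | hab
  · have := mul_le_mul_of_nonneg_left hba (H.mul_self_nonneg ha)
    linarith [H.mul_sq_le_prim hgl ha]
  · have := mul_le_mul_of_nonneg_right
      ((H.strictMonoOn_mul_self hgl).monotoneOn ha hb hab) hb
    linarith [H.mul_sq_le_prim hgl hb]

theorem tendsto_prim_zero (H : IsProfile gl gu h) (hgl : 0 < gl) {a : ℕ → ℝ}
    (ha : Tendsto a atTop (𝓝 0)) : Tendsto (fun n => prim h |a n|) atTop (𝓝 0) := by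
  have h1 : Tendsto (fun n => |a n| * prim h 1) atTop (𝓝 0) := by
    simpa using (ha.abs).mul_const (prim h 1)
  refine squeeze_zero' (Eventually.of_forall fun n => H.prim_nonneg hgl (abs_nonneg _)) ?_ h1
  have h2 : ∀ᶠ n in atTop, |a n| ≤ 1 := by
    have := ha.abs
    rw [abs_zero] at this
    exact this.eventually_le_const one_pos
  filter_upwards [h2] with n hn
  simpa using H.prim_contract hgl (abs_nonneg (a n)) hn zero_le_one

theorem tendsto_zero_of_prim (H : IsProfile gl gu h) (hgl : 0 < gl) {a : ℕ → ℝ}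
    (ha : Tendsto (fun n => prim h |a n|) atTop (𝓝 0)) : Tendsto a atTop (𝓝 0) := by
  rw [Metric.tendsto_atTop']
  intro ε hε
  obtain ⟨N, hN⟩ := eventually_atTop.1 (ha.eventually_lt_const (H.prim_pos hgl hε))
  refine ⟨N, fun n hn => ?_⟩
  rw [Real.dist_eq, sub_zero]
  by_contra hc
  exact absurd (hN n hn.le) (not_lt.2 (H.prim_mono hgl hε.le (not_lt.1 hc)))

/-- The vector field `t ↦ h(|t|) t` is strictly monotone. -/
theorem strictMono_field (H : IsProfile gl gu h) (hgl : 0 < gl) :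
    StrictMono (fun t => h |t| * t) := by
  have hm := H.strictMonoOn_mul_self hgl
  have hpos : ∀ t : ℝ, 0 < t → 0 < h |t| * t := fun t ht => by
    rw [abs_of_pos ht]; exact mul_pos (H.pos t ht) ht
  have hnn : ∀ t : ℝ, 0 ≤ t → 0 ≤ h |t| * t := fun t ht => by
    rw [abs_of_nonneg ht]; exact H.mul_self_nonneg ht
  intro a b hab
  simp only
  rcases le_or_gt 0 a with ha | ha
  · have := hm ha (ha.trans hab.le) hab
    rwa [abs_of_nonneg ha, abs_of_nonneg (ha.trans hab.le)]
  · have h1 := hpos (-a) (by linarith)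
    rw [abs_neg] at h1
    rcases le_or_gt 0 b with hb | hb
    · linarith [hnn b hb]
    · have := @hm (-b) (by simp; linarith) (-a) (by simp; linarith) (by linarith)
      simp only at this
      rw [abs_of_neg ha, abs_of_neg hb]
      linarith

end IsProfile

end FracOrlicz
-- Modulars of a measurable family of profiles.
namespace FracOrlicz

/-- A measurable family of profiles over a measure space, with a nonnegative weight `k`. -/
structure IsProfileFamily {X : Type*} [MeasurableSpace X] (μ : Measure X) (gl gu : ℝ)
    (H : X → ℝ → ℝ) (k : X → ℝ) : Prop where
  gl_pos : 0 < gl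
  measurable : Measurable (fun q : X × ℝ => H q.1 q.2)
  profile : ∀ᵐ p ∂μ, IsProfile gl gu (H p)
  measurable_weight : Measurable k
  weight_nonneg : ∀ p, 0 ≤ k p

/-- The modular `∫ P(p, |f(p)|) / k(p) dμ(p)`, where `P(p, ·)` is the primitive of `H(p, ·)`. -/
noncomputable def familyModular {X : Type*} [MeasurableSpace X] (μ : Measure X) (H : X → ℝ → ℝ)
    (k : X → ℝ) (f : X → ℝ) : ℝ≥0∞ :=
  ∫⁻ p, ENNReal.ofReal (prim (H p) |f p| / k p) ∂μ

namespace IsProfileFamily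

variable {X : Type*} [MeasurableSpace X] {μ : Measure X} {gl gu : ℝ} {H : X → ℝ → ℝ} {k : X → ℝ}

theorem measurable_prim (hH : IsProfileFamily μ gl gu H k) :
    Measurable (fun q : X × ℝ => prim (H q.1) |q.2|) := by
  -- Moving the variable endpoint into the integrand leaves a parameter integral over all of `ℝ`, to
  -- which Fubini measurability applies.
  have e : (fun q : X × ℝ => prim (H q.1) |q.2|) = fun q : X × ℝ =>
      ∫ ρ : ℝ, if 0 < ρ ∧ ρ ≤ |q.2| then H q.1 ρ * ρ else 0 := by
    ext q
    rw [prim, intervalIntegral.integral_of_le (abs_nonneg _),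
      ← integral_indicator measurableSet_Ioc]
    simp only [indicator_apply, mem_Ioc]
  rw [e]
  refine (StronglyMeasurable.integral_prod_right (f := fun (q : X × ℝ) (ρ : ℝ) =>
    if 0 < ρ ∧ ρ ≤ |q.2| then H q.1 ρ * ρ else 0) ?_).measurable
  refine (Measurable.ite ?_ ?_ measurable_const).stronglyMeasurable
  · exact (measurableSet_lt measurable_const measurable_snd).inter
      (measurableSet_le measurable_snd
        (continuous_abs.measurable.comp (measurable_snd.comp measurable_fst)))
  · exact (hH.measurable.comp
      ((measurable_fst.comp measurable_fst).prodMk measurable_snd)).mul measurable_snd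

theorem aemeasurable_integrand (hH : IsProfileFamily μ gl gu H k) {f : X → ℝ}
    (hf : AEMeasurable f μ) :
    AEMeasurable (fun p => ENNReal.ofReal (prim (H p) |f p| / k p)) μ :=
  ((hH.measurable_prim.comp_aemeasurable (aemeasurable_id.prodMk hf)).div
    hH.measurable_weight.aemeasurable).ennreal_ofReal

theorem familyModular_contract (hH : IsProfileFamily μ gl gu H k) {f f' : X → ℝ} {t : ℝ}
    (ht : 0 ≤ t) (ht1 : t ≤ 1) (hf : ∀ p, f' p = t * f p) :
    familyModular μ H k f' ≤ ENNReal.ofReal t * familyModular μ H k f := by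
  rw [familyModular, familyModular, ← lintegral_const_mul' _ _ ENNReal.ofReal_ne_top]
  refine lintegral_mono_ae ?_
  filter_upwards [hH.profile] with p hp
  rw [← ENNReal.ofReal_mul ht, hf, abs_mul, abs_of_nonneg ht, ← mul_div_assoc]
  exact ENNReal.ofReal_le_ofReal (div_le_div_of_nonneg_right
    (hp.prim_contract hH.gl_pos ht ht1 (abs_nonneg _)) (hH.weight_nonneg p))

theorem familyModular_scale (hH : IsProfileFamily μ gl gu H k) {f f' : X → ℝ} {c : ℝ}
    (hc : 1 ≤ c) (hf : ∀ p, f' p = c * f p) :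
    familyModular μ H k f' ≤ ENNReal.ofReal (c * c ^ gu) * familyModular μ H k f := by
  have hc0 : 0 ≤ c := by linarith
  rw [familyModular, familyModular, ← lintegral_const_mul' _ _ ENNReal.ofReal_ne_top]
  refine lintegral_mono_ae ?_
  filter_upwards [hH.profile] with p hp
  rw [← ENNReal.ofReal_mul (by positivity), hf, abs_mul, abs_of_nonneg hc0, ← mul_div_assoc]
  exact ENNReal.ofReal_le_ofReal (div_le_div_of_nonneg_right
    (hp.prim_scale hH.gl_pos hc (abs_nonneg _)) (hH.weight_nonneg p))

theorem integrand_le (hH : IsProfileFamily μ gl gu H k) {p : X} (hp : IsProfile gl gu (H p))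
    {r a b : ℝ} (hr : |r| ≤ |a| + |b|) :
    ENNReal.ofReal (prim (H p) |r| / k p) ≤ ENNReal.ofReal (2 * 2 ^ gu) *
      (ENNReal.ofReal (prim (H p) |a| / k p) + ENNReal.ofReal (prim (H p) |b| / k p)) := by
  have h0 := hH.weight_nonneg p
  have h1 := div_nonneg (hp.prim_nonneg hH.gl_pos (abs_nonneg a)) h0
  have h2 := div_nonneg (hp.prim_nonneg hH.gl_pos (abs_nonneg b)) h0
  rw [← ENNReal.ofReal_add h1 h2, ← ENNReal.ofReal_mul (by positivity), ← add_div,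
    ← mul_div_assoc]
  exact ENNReal.ofReal_le_ofReal (div_le_div_of_nonneg_right
    ((hp.prim_mono hH.gl_pos (abs_nonneg _) hr).trans
      (hp.prim_add_le hH.gl_pos (abs_nonneg _) (abs_nonneg _))) h0)

theorem familyModular_le_add (hH : IsProfileFamily μ gl gu H k) {f a b : X → ℝ}
    (ha : AEMeasurable a μ) (hf : ∀ p, |f p| ≤ |a p| + |b p|) :
    familyModular μ H k f ≤ ENNReal.ofReal (2 * 2 ^ gu) *
      (familyModular μ H k a + familyModular μ H k b) := by
  rw [familyModular, familyModular, familyModular,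
    ← lintegral_add_left' (hH.aemeasurable_integrand ha),
    ← lintegral_const_mul' _ _ ENNReal.ofReal_ne_top]
  refine lintegral_mono_ae ?_
  filter_upwards [hH.profile] with p hp using hH.integrand_le hp (hf p)

theorem familyModular_mono (hH : IsProfileFamily μ gl gu H k) {f a : X → ℝ}
    (hf : ∀ p, |f p| ≤ |a p|) : familyModular μ H k f ≤ familyModular μ H k a := by
  refine lintegral_mono_ae ?_
  filter_upwards [hH.profile] with p hp
  exact ENNReal.ofReal_le_ofReal (div_le_div_of_nonneg_right
    (hp.prim_mono hH.gl_pos (abs_nonneg _) (hf p)) (hH.weight_nonneg p))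

/-- Writing `Φ` for the modular integrand, `Φ (f n) ≤ K Φ (a n) + min (Φ (f n)) (K Φ b)`. The first
term vanishes in the limit by assumption, the second by dominated convergence with the fixed
majorant `K Φ b`. -/
theorem tendsto_familyModular_zero (hH : IsProfileFamily μ gl gu H k) {f a : ℕ → X → ℝ}
    {b : X → ℝ} (hfm : ∀ n, AEMeasurable (f n) μ) (ham : ∀ n, AEMeasurable (a n) μ)
    (hbm : AEMeasurable b μ) (hle : ∀ n p, |f n p| ≤ |a n p| + |b p|)
    (hlim : ∀ᵐ p ∂μ, Tendsto (fun n => f n p) atTop (𝓝 0))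
    (ha : Tendsto (fun n => familyModular μ H k (a n)) atTop (𝓝 0))
    (hb : familyModular μ H k b ≠ ∞) :
    Tendsto (fun n => familyModular μ H k (f n)) atTop (𝓝 0) := by
  set K := ENNReal.ofReal (2 * 2 ^ gu) with hK
  have hKtop : K ≠ ∞ := ENNReal.ofReal_ne_top
  let Φ : (X → ℝ) → X → ℝ≥0∞ := fun v p => ENNReal.ofReal (prim (H p) |v p| / k p)
  have hmin : Tendsto (fun n => ∫⁻ p, min (Φ (f n) p) (K * Φ b p) ∂μ) atTop (𝓝 0) := by
    have := tendsto_lintegral_of_dominated_convergence' (μ := μ) (f := fun _ => 0)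
      (F := fun n p => min (Φ (f n) p) (K * Φ b p)) (fun p => K * Φ b p)
      (fun n => (hH.aemeasurable_integrand (hfm n)).min
        ((hH.aemeasurable_integrand hbm).const_mul K))
      (fun n => Eventually.of_forall fun p => min_le_right _ _) ?_ ?_
    · simpa using this
    · rw [lintegral_const_mul' _ _ hKtop]
      exact ENNReal.mul_ne_top hKtop hb
    · filter_upwards [hH.profile, hlim] with p hp hlp
      have h1 : Tendsto (fun n => Φ (f n) p) atTop (𝓝 0) := by
        have := ENNReal.tendsto_ofReal ((hp.tendsto_prim_zero hH.gl_pos hlp).div_const (k p))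
        simpa using this
      exact tendsto_of_tendsto_of_tendsto_of_le_of_le tendsto_const_nhds h1
        (fun _ => zero_le) (fun _ => min_le_left _ _)
  have hsum : Tendsto (fun n => K * familyModular μ H k (a n)
      + ∫⁻ p, min (Φ (f n) p) (K * Φ b p) ∂μ) atTop (𝓝 0) := by
    simpa using (ENNReal.Tendsto.const_mul ha (Or.inr hKtop)).add hmin
  refine tendsto_of_tendsto_of_tendsto_of_le_of_le tendsto_const_nhds hsum
    (fun _ => zero_le) fun n => ?_
  simp only
  rw [familyModular, familyModular, ← lintegral_const_mul' _ _ hKtop,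
    ← lintegral_add_left' ((hH.aemeasurable_integrand (ham n)).const_mul K)]
  refine lintegral_mono_ae ?_
  filter_upwards [hH.profile] with p hp
  have h1 : Φ (f n) p ≤ K * (Φ (a n) p + Φ b p) := hH.integrand_le hp (hle n p)
  change Φ (f n) p ≤ K * Φ (a n) p + min (Φ (f n) p) (K * Φ b p)
  rcases le_total (Φ (f n) p) (K * Φ b p) with hc | hc
  · rw [min_eq_left hc]; exact le_add_self
  · rw [min_eq_right hc, ← mul_add]; exact h1

/-- Summable modulars make the sum of the integrands finite almost everywhere, so the whole sequence
converges and no subsequence is needed. -/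
theorem ae_tendsto_zero (hH : IsProfileFamily μ gl gu H k) (hk : ∀ p, 0 < k p) {a : ℕ → X → ℝ}
    (ham : ∀ n, AEMeasurable (a n) μ) (ha : ∑' n, familyModular μ H k (a n) ≠ ∞) :
    ∀ᵐ p ∂μ, Tendsto (fun n => a n p) atTop (𝓝 0) := by
  unfold familyModular at ha
  rw [← lintegral_tsum fun n => hH.aemeasurable_integrand (ham n)] at ha
  filter_upwards [hH.profile, ae_lt_top' (AEMeasurable.tsum
    fun n => hH.aemeasurable_integrand (ham n)) ha] with p hp hlt
  have h1 := ENNReal.tendsto_atTop_zero_of_tsum_ne_top hlt.ne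
  have h2 := (ENNReal.tendsto_toReal ENNReal.zero_ne_top).comp h1
  apply hp.tendsto_zero_of_prim hH.gl_pos
  have h3 : Tendsto (fun n => prim (H p) |a n p| / k p * k p) atTop (𝓝 (0 * k p)) := by
    refine Tendsto.mul_const _ ?_
    refine h2.congr fun n => ?_
    exact ENNReal.toReal_ofReal (div_nonneg (hp.prim_nonneg hH.gl_pos (abs_nonneg _)) (hk p).le)
  simpa [(hk p).ne'] using h3

theorem integrable_field_mul (hH : IsProfileFamily μ gl gu H k) {a b : X → ℝ}
    (ham : AEMeasurable a μ) (hbm : AEMeasurable b μ) (ha : familyModular μ H k a ≠ ∞)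
    (hb : familyModular μ H k b ≠ ∞) :
    Integrable (fun p => H p |a p| * a p * b p / k p) μ := by
  have hint : ∀ {c : X → ℝ}, AEMeasurable c μ → familyModular μ H k c ≠ ∞ →
      Integrable (fun p => prim (H p) |c p| / k p) μ := fun {c} hcm hc => by
    refine ⟨((hH.measurable_prim.comp_aemeasurable (aemeasurable_id.prodMk hcm)).div
      hH.measurable_weight.aemeasurable).aestronglyMeasurable, ?_⟩
    rw [hasFiniteIntegral_iff_ofReal]
    · exact hc.lt_top
    · filter_upwards [hH.profile] with p hp
      exact div_nonneg (hp.prim_nonneg hH.gl_pos (abs_nonneg _)) (hH.weight_nonneg p)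
  refine (((hint ham ha).add (hint hbm hb)).const_mul (2 * 2 ^ gu)).mono' ?_ ?_
  · exact ((((hH.measurable.comp_aemeasurable (aemeasurable_id.prodMk
      (continuous_abs.measurable.comp_aemeasurable ham))).mul ham).mul hbm).div
      hH.measurable_weight.aemeasurable).aestronglyMeasurable
  · filter_upwards [hH.profile] with p hp
    have h1 := hp.mul_mul_le_prim hH.gl_pos (abs_nonneg (a p)) (abs_nonneg (b p))
    -- The sign of `H p 0` is unknown, so only the product with `|a p|` is known to be nonnegative.
    have h2 : abs (H p |a p|) * |a p| = H p |a p| * |a p| := by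
      have := hp.mul_self_nonneg (abs_nonneg (a p))
      rw [← abs_of_nonneg this, abs_mul, abs_abs]
    rw [Real.norm_eq_abs, abs_div, abs_mul, abs_mul, h2, abs_of_nonneg (hH.weight_nonneg p)]
    simp only [Pi.add_apply]
    rw [← add_div, ← mul_div_assoc]
    exact div_le_div_of_nonneg_right h1 (hH.weight_nonneg p)

end IsProfileFamily

end FracOrlicz
-- Smooth truncation, and passage from modulars to Luxemburg norms.
namespace FracOrlicz

/-- A smooth `1`-Lipschitz approximation of the positive part that vanishes at `0`. -/
noncomputable def smoothPos (ε t : ℝ) : ℝ := (t + √(t ^ 2 + ε ^ 2) - ε) / 2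

theorem smoothPos_zero {ε : ℝ} (hε : 0 < ε) : smoothPos ε 0 = 0 := by
  simp [smoothPos, Real.sqrt_sq hε.le]

theorem contDiff_smoothPos {ε : ℝ} (hε : 0 < ε) {n : WithTop ℕ∞} :
    ContDiff ℝ n (smoothPos ε) := by
  have h : ContDiff ℝ n fun t : ℝ => √(t ^ 2 + ε ^ 2) :=
    ((contDiff_id.pow 2).add contDiff_const).sqrt fun t => by positivity
  exact ((contDiff_id.add h).sub contDiff_const).div_const 2

theorem sqrt_sq_add_sq_sub_le (ε a b : ℝ) :
    √(a ^ 2 + ε ^ 2) - √(b ^ 2 + ε ^ 2) ≤ |a - b| := by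
  have hB : 0 ≤ √(b ^ 2 + ε ^ 2) := Real.sqrt_nonneg _
  have hB2 : √(b ^ 2 + ε ^ 2) ^ 2 = b ^ 2 + ε ^ 2 := Real.sq_sqrt (by positivity)
  have hb : |b| ≤ √(b ^ 2 + ε ^ 2) := Real.abs_le_sqrt (by nlinarith [sq_nonneg ε])
  rw [sub_le_iff_le_add, Real.sqrt_le_left (by positivity)]
  have h1 : b * (a - b) ≤ √(b ^ 2 + ε ^ 2) * |a - b| :=
    (le_abs_self _).trans ((abs_mul _ _).trans_le
      (mul_le_mul_of_nonneg_right hb (abs_nonneg _)))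
  have h2 : |a - b| ^ 2 = (a - b) ^ 2 := sq_abs _
  nlinarith

theorem abs_smoothPos_sub_le (ε a b : ℝ) : |smoothPos ε a - smoothPos ε b| ≤ |a - b| := by
  have h1 := sqrt_sq_add_sq_sub_le ε a b
  have h2 := sqrt_sq_add_sq_sub_le ε b a
  rw [abs_sub_comm b a] at h2
  have h3 := abs_le.1 (le_refl |a - b|)
  unfold smoothPos
  rw [abs_le]
  constructor <;> linarith

theorem abs_smoothPos_sub_max_le {ε : ℝ} (hε : 0 < ε) (t : ℝ) :
    |smoothPos ε t - max t 0| ≤ ε := by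
  have h1 : |t| ≤ √(t ^ 2 + ε ^ 2) := Real.abs_le_sqrt (by nlinarith [sq_nonneg ε])
  have h2 : √(t ^ 2 + ε ^ 2) ≤ |t| + ε := by
    rw [Real.sqrt_le_left (by positivity)]
    nlinarith [sq_abs t, abs_nonneg t]
  have h3 : max t 0 = (t + |t|) / 2 := by
    rcases le_total 0 t with h | h
    · rw [max_eq_left h, abs_of_nonneg h]; ring
    · rw [max_eq_right h, abs_of_nonpos h]; ring
  rw [h3, smoothPos, abs_le]
  constructor <;> linarith

theorem abs_max_zero_sub_le (a b : ℝ) : |max a 0 - max b 0| ≤ |a - b| :=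
  abs_max_sub_max_le_abs a b 0

theorem le_ofReal_of_luxemburg_lt {d : ℕ} {Γ : (EuclideanSpace ℝ (Fin d) → ℝ) → ℝ≥0∞}
    {u : EuclideanSpace ℝ (Fin d) → ℝ}
    (hΓ : ∀ (t : ℝ) (v v' : EuclideanSpace ℝ (Fin d) → ℝ), 0 ≤ t → t ≤ 1 →
      (∀ x, v' x = t * v x) → Γ v' ≤ ENNReal.ofReal t * Γ v)
    {ε : ℝ} (hε : ε ≤ 1) (h : luxemburg Γ u < ENNReal.ofReal ε) : Γ u ≤ ENNReal.ofReal ε := by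
  unfold luxemburg at h
  simp only [iInf_lt_iff] at h
  obtain ⟨t, ⟨ht, ht1⟩, hlt⟩ := h
  have htε : t < ε := (ENNReal.ofReal_lt_ofReal_iff_of_nonneg ht.le).1 hlt
  calc Γ u ≤ ENNReal.ofReal t * Γ (fun x => u x / t) :=
        hΓ t _ _ ht.le (htε.le.trans hε) fun x => by field_simp
    _ ≤ ENNReal.ofReal t * 1 := by gcongr
    _ ≤ ENNReal.ofReal ε := by rw [mul_one]; exact hlt.le

theorem luxemburg_le_ofReal {d : ℕ} {Γ : (EuclideanSpace ℝ (Fin d) → ℝ) → ℝ≥0∞}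
    {u : EuclideanSpace ℝ (Fin d) → ℝ} {t : ℝ} (ht : 0 < t) (h : Γ (fun x => u x / t) ≤ 1) :
    luxemburg Γ u ≤ ENNReal.ofReal t :=
  iInf₂_le t ⟨ht, h⟩

namespace IsProfileFamily

variable {X : Type*} [MeasurableSpace X] {μ : Measure X} {gl gu : ℝ} {H : X → ℝ → ℝ} {k : X → ℝ}

/-- Meant for `W` the positive part of `Z` and `B n` the smoothed positive part of `χ n`, or their
difference quotients. With `c = 1 / t` the conclusion bounds the Luxemburg functional of `W - B n`
by `t`. -/
theorem eventually_familyModular_le_one (hH : IsProfileFamily μ gl gu H k) {Z W : X → ℝ}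
    {χ B : ℕ → X → ℝ} {c : ℝ} (hc : 1 ≤ c) (hZm : AEMeasurable Z μ) (hWm : AEMeasurable W μ)
    (hχm : ∀ n, AEMeasurable (χ n) μ) (hBm : ∀ n, AEMeasurable (B n) μ)
    (hW : ∀ p, |W p| ≤ |Z p|) (hB : ∀ n p, |B n p| ≤ |χ n p|)
    (hZ : familyModular μ H k Z ≠ ∞)
    (hχ : Tendsto (fun n => familyModular μ H k (fun p => Z p - χ n p)) atTop (𝓝 0))
    (hlim : ∀ᵐ p ∂μ, Tendsto (fun n => W p - B n p) atTop (𝓝 0)) :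
    ∀ᶠ n in atTop, ∀ f : X → ℝ, (∀ p, f p = c * (W p - B n p)) → familyModular μ H k f ≤ 1 := by
  have h1 : Tendsto (fun n => familyModular μ H k (fun p => W p - B n p)) atTop (𝓝 0) := by
    -- The majorant comes from `|W - B n| ≤ |Z| + |χ n| ≤ |Z - χ n| + 2 |Z|`.
    refine hH.tendsto_familyModular_zero (b := fun p => 2 * Z p)
      (fun n => hWm.sub (hBm n)) (fun n => hZm.sub (hχm n)) (hZm.const_mul 2)
      (fun n p => ?_) hlim hχ ?_
    · have e1 := abs_sub (W p) (B n p)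
      have e2 := abs_sub_abs_le_abs_sub (χ n p) (Z p)
      rw [abs_sub_comm] at e2
      change _ ≤ |Z p - χ n p| + |2 * Z p|
      rw [abs_mul, abs_two]
      linarith [hW p, hB n p]
    · exact ne_top_of_le_ne_top (ENNReal.mul_ne_top ENNReal.ofReal_ne_top hZ)
        (hH.familyModular_scale one_le_two fun p => rfl)
  have h2 := ENNReal.Tendsto.const_mul (a := ENNReal.ofReal (c * c ^ gu)) h1
    (Or.inr ENNReal.ofReal_ne_top)
  rw [mul_zero] at h2
  filter_upwards [h2.eventually_le_const one_pos] with n hn f hf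
  exact (hH.familyModular_scale hc hf).trans hn

end IsProfileFamily

/-! ### The two modulars of the space, and stability of `W₀^{s,G}(Ω)` under positive parts of
differences. -/

variable {d : ℕ} {gl gu s : ℝ} {g : EuclideanSpace ℝ (Fin d) → EuclideanSpace ℝ (Fin d) → ℝ → ℝ}
  {Ω : Set (EuclideanSpace ℝ (Fin d))} {u v : EuclideanSpace ℝ (Fin d) → ℝ}

theorem IsNonlinearity.diagFamily (hg : IsNonlinearity gl gu g) :
    IsProfileFamily volume gl gu (fun x => g x x) (fun _ => 1) where
  gl_pos := hg.gl_pos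
  measurable := hg.measurable.comp
    (measurable_fst.prodMk (measurable_fst.prodMk measurable_snd))
  profile := hg.profile_diag
  measurable_weight := measurable_const
  weight_nonneg _ := zero_le_one

theorem IsNonlinearity.pairFamily (hg : IsNonlinearity gl gu g) :
    IsProfileFamily volume gl gu
      (fun p : EuclideanSpace ℝ (Fin d) × EuclideanSpace ℝ (Fin d) => g p.1 p.2)
      (fun p => ‖p.1 - p.2‖ ^ d) where
  gl_pos := hg.gl_pos
  measurable := hg.measurable.comp
    ((measurable_fst.comp measurable_fst).prodMk
      ((measurable_snd.comp measurable_fst).prodMk measurable_snd))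
  profile := hg.profile
  measurable_weight := ((measurable_fst.sub measurable_snd).norm).pow_const d
  weight_nonneg _ := by positivity

theorem modular_eq_familyModular (g : EuclideanSpace ℝ (Fin d) → EuclideanSpace ℝ (Fin d) → ℝ → ℝ)
    (u : EuclideanSpace ℝ (Fin d) → ℝ) :
    modular g u = familyModular volume (fun x => g x x) (fun _ => 1) u := by
  simp only [modular, familyModular, div_one]
  rfl

theorem fracModular_eq_familyModular
    (g : EuclideanSpace ℝ (Fin d) → EuclideanSpace ℝ (Fin d) → ℝ → ℝ) (s : ℝ)
    (u : EuclideanSpace ℝ (Fin d) → ℝ) :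
    fracModular g s u = familyModular volume
      (fun p : EuclideanSpace ℝ (Fin d) × EuclideanSpace ℝ (Fin d) => g p.1 p.2)
      (fun p => ‖p.1 - p.2‖ ^ d) (fun p => diffQuot s u p.1 p.2) := rfl

theorem diffQuot_sub (s : ℝ) (u v : EuclideanSpace ℝ (Fin d) → ℝ)
    (x y : EuclideanSpace ℝ (Fin d)) :
    diffQuot s (fun x => u x - v x) x y = diffQuot s u x y - diffQuot s v x y := by
  simp only [diffQuot]; ring

theorem diffQuot_mul (s c : ℝ) (u v : EuclideanSpace ℝ (Fin d) → ℝ) (h : ∀ x, v x = c * u x)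
    (x y : EuclideanSpace ℝ (Fin d)) : diffQuot s v x y = c * diffQuot s u x y := by
  simp only [diffQuot, h]; ring

theorem abs_diffQuot_le (s : ℝ) {u v : EuclideanSpace ℝ (Fin d) → ℝ}
    {x y : EuclideanSpace ℝ (Fin d)} (h : |u x - u y| ≤ |v x - v y|) :
    |diffQuot s u x y| ≤ |diffQuot s v x y| := by
  simp only [diffQuot, abs_div]
  gcongr

theorem aemeasurable_diffQuot (s : ℝ) (hu : AEMeasurable u) :
    AEMeasurable (fun p : EuclideanSpace ℝ (Fin d) × EuclideanSpace ℝ (Fin d) =>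
      diffQuot s u p.1 p.2) :=
  ((hu.comp_quasiMeasurePreserving Measure.quasiMeasurePreserving_fst).sub
    (hu.comp_quasiMeasurePreserving Measure.quasiMeasurePreserving_snd)).div
    (((measurable_fst.sub measurable_snd).norm).pow_const s).aemeasurable

theorem modular_contract (hg : IsNonlinearity gl gu g) (t : ℝ)
    (v v' : EuclideanSpace ℝ (Fin d) → ℝ) (ht : 0 ≤ t) (ht1 : t ≤ 1) (h : ∀ x, v' x = t * v x) :
    modular g v' ≤ ENNReal.ofReal t * modular g v := by
  simp only [modular_eq_familyModular]
  exact hg.diagFamily.familyModular_contract ht ht1 h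

theorem fracModular_contract (hg : IsNonlinearity gl gu g) (t : ℝ)
    (v v' : EuclideanSpace ℝ (Fin d) → ℝ) (ht : 0 ≤ t) (ht1 : t ≤ 1) (h : ∀ x, v' x = t * v x) :
    fracModular g s v' ≤ ENNReal.ofReal t * fracModular g s v := by
  simp only [fracModular_eq_familyModular]
  exact hg.pairFamily.familyModular_contract ht ht1 fun p => diffQuot_mul s t v v' h p.1 p.2

theorem modular_sub_le (hg : IsNonlinearity gl gu g) (hu : AEMeasurable u) :
    modular g (fun x => u x - v x) ≤ ENNReal.ofReal (2 * 2 ^ gu) * (modular g u + modular g v) := by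
  simp only [modular_eq_familyModular]
  exact hg.diagFamily.familyModular_le_add hu fun p => abs_sub _ _

theorem fracModular_sub_le (hg : IsNonlinearity gl gu g) (hu : AEMeasurable u) :
    fracModular g s (fun x => u x - v x) ≤
      ENNReal.ofReal (2 * 2 ^ gu) * (fracModular g s u + fracModular g s v) := by
  simp only [fracModular_eq_familyModular]
  refine hg.pairFamily.familyModular_le_add (aemeasurable_diffQuot s hu) fun p => ?_
  rw [diffQuot_sub]
  exact abs_sub _ _

/-- The geometric rate provides the summability that `ae_tendsto_zero` requires. -/
theorem MemW0.exists_seq (hg : IsNonlinearity gl gu g) (hu : MemW0 g s Ω u) :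
    ∃ φ : ℕ → EuclideanSpace ℝ (Fin d) → ℝ, (∀ n, IsTest Ω (φ n)) ∧
      (∀ n, modular g (fun x => u x - φ n x) ≤ ENNReal.ofReal ((1 / 2) ^ n)) ∧
      ∀ n, fracModular g s (fun x => u x - φ n x) ≤ ENNReal.ofReal ((1 / 2) ^ n) := by
  have h : ∀ n : ℕ, ∃ φ : EuclideanSpace ℝ (Fin d) → ℝ, IsTest Ω φ ∧
      normW g s (fun x => u x - φ x) < ENNReal.ofReal ((1 / 2) ^ n) := fun n =>
    hu.approx _ (ENNReal.ofReal_pos.2 (by positivity))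
  choose φ hφ hn using h
  have h1 : ∀ n : ℕ, ((1 : ℝ) / 2) ^ n ≤ 1 := fun n => pow_le_one₀ (by norm_num) (by norm_num)
  exact ⟨φ, hφ,
    fun n => le_ofReal_of_luxemburg_lt (modular_contract hg) (h1 n) (le_self_add.trans_lt (hn n)),
    fun n => le_ofReal_of_luxemburg_lt (fracModular_contract hg) (h1 n)
      (le_add_self.trans_lt (hn n))⟩

theorem IsTest.smoothPos_sub {φ ψ : EuclideanSpace ℝ (Fin d) → ℝ} (hφ : IsTest Ω φ)
    (hψ : IsTest Ω ψ) {ε : ℝ} (hε : 0 < ε) : IsTest Ω (fun x => smoothPos ε (φ x - ψ x)) := by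
  have hsub : tsupport (fun x => smoothPos ε (φ x - ψ x)) ⊆ tsupport φ ∪ tsupport ψ := by
    refine closure_minimal (fun x hx => ?_) ((isClosed_tsupport φ).union (isClosed_tsupport ψ))
    by_contra hc
    rw [mem_union, not_or] at hc
    exact hx (by simp [image_eq_zero_of_notMem_tsupport hc.1,
      image_eq_zero_of_notMem_tsupport hc.2, smoothPos_zero hε])
  exact ⟨(contDiff_smoothPos hε).comp (hφ.contDiff.sub hψ.contDiff),
    (hφ.hasCompactSupport.isCompact.union hψ.hasCompactSupport.isCompact).of_isClosed_subset
      (isClosed_tsupport _) hsub,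
    hsub.trans (union_subset hφ.tsupport_subset hψ.tsupport_subset)⟩

theorem IsTest.aemeasurable {φ : EuclideanSpace ℝ (Fin d) → ℝ} (hφ : IsTest Ω φ) :
    AEMeasurable φ := hφ.contDiff.continuous.aemeasurable

theorem tsum_ofReal_half_pow_ne_top {C : ℝ≥0∞} (hC : C ≠ ∞) :
    ∑' n : ℕ, C * (ENNReal.ofReal ((1 / 2) ^ n) + ENNReal.ofReal ((1 / 2) ^ n)) ≠ ∞ := by
  have h : ∑' n : ℕ, ENNReal.ofReal ((1 / 2) ^ n) ≠ ∞ :=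
    (summable_geometric_of_lt_one (by norm_num) (by norm_num)).tsum_ofReal_ne_top
  rw [ENNReal.tsum_mul_left, ENNReal.tsum_add]
  exact ENNReal.mul_ne_top hC (ENNReal.add_ne_top.2 ⟨h, h⟩)

/-- `W^{s,G}(ℝᵈ)` contains the positive part of the difference of two of its elements. -/
theorem MemW.posPart_sub (hg : IsNonlinearity gl gu g) (hu : MemW g s u) (hv : MemW g s v) :
    MemW g s (fun x => max (u x - v x) 0) := by
  refine ⟨(hu.aemeasurable.sub hv.aemeasurable).max aemeasurable_const, ?_, ?_⟩
  · refine lt_of_le_of_lt ?_ ((modular_sub_le (v := v) hg hu.aemeasurable).trans_lt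
      (ENNReal.mul_lt_top ENNReal.ofReal_lt_top
        (ENNReal.add_lt_top.2 ⟨hu.modular_lt_top, hv.modular_lt_top⟩)))
    simp only [modular_eq_familyModular]
    refine hg.diagFamily.familyModular_mono fun x => ?_
    simpa using abs_max_zero_sub_le (u x - v x) 0
  · refine lt_of_le_of_lt ?_ ((fracModular_sub_le (v := v) hg hu.aemeasurable).trans_lt
      (ENNReal.mul_lt_top ENNReal.ofReal_lt_top
        (ENNReal.add_lt_top.2 ⟨hu.fracModular_lt_top, hv.fracModular_lt_top⟩)))
    simp only [fracModular_eq_familyModular]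
    exact hg.pairFamily.familyModular_mono fun p =>
      abs_diffQuot_le s (abs_max_zero_sub_le (u p.1 - v p.1) (u p.2 - v p.2))

/-- `W₀^{s,G}(Ω)` contains the positive part of the difference of two of its elements. -/
theorem MemW0.posPart_sub (hg : IsNonlinearity gl gu g) (hu : MemW0 g s Ω u)
    (hv : MemW0 g s Ω v) : MemW0 g s Ω (fun x => max (u x - v x) 0) := by
  refine ⟨hu.memW.posPart_sub hg hv.memW, ?_, fun ε hε => ?_⟩
  · filter_upwards [hu.ae_zero, hv.ae_zero] with x h1 h2 hx
    simp [h1 hx, h2 hx]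
  obtain ⟨φ, hφ, hφ1, hφ2⟩ := hu.exists_seq hg
  obtain ⟨ψ, hψ, hψ1, hψ2⟩ := hv.exists_seq hg
  have hum := hu.memW.aemeasurable
  have hvm := hv.memW.aemeasurable
  set K := ENNReal.ofReal (2 * 2 ^ gu)
  have hK : K ≠ ∞ := ENNReal.ofReal_ne_top
  let e : ℕ → ℝ := fun n => 1 / ((n : ℝ) + 1)
  have he : ∀ n, 0 < e n := fun n => Nat.one_div_pos_of_nat
  let Z : EuclideanSpace ℝ (Fin d) → ℝ := fun x => u x - v x
  let χ : ℕ → EuclideanSpace ℝ (Fin d) → ℝ := fun n x => φ n x - ψ n x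
  let W : EuclideanSpace ℝ (Fin d) → ℝ := fun x => max (Z x) 0
  let B : ℕ → EuclideanSpace ℝ (Fin d) → ℝ := fun n x => smoothPos (e n) (χ n x)
  have hZm : AEMeasurable Z := hum.sub hvm
  have hWm : AEMeasurable W := hZm.max aemeasurable_const
  have hχm : ∀ n, AEMeasurable (χ n) := fun n => (hφ n).aemeasurable.sub (hψ n).aemeasurable
  have hBt : ∀ n, IsTest Ω (B n) := fun n => (hφ n).smoothPos_sub (hψ n) (he n)
  have hBm : ∀ n, AEMeasurable (B n) := fun n => (hBt n).aemeasurable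
  have hrw : ∀ n, (fun x => Z x - χ n x) = fun x => (u x - φ n x) - (v x - ψ n x) := fun n => by
    ext x; simp only [Z, χ]; ring
  have hmod : ∀ n, modular g (fun x => Z x - χ n x) ≤
      K * (ENNReal.ofReal ((1 / 2) ^ n) + ENNReal.ofReal ((1 / 2) ^ n)) := fun n => by
    rw [hrw]
    exact (modular_sub_le hg (hum.sub (hφ n).aemeasurable)).trans (by gcongr; exacts [hφ1 n, hψ1 n])
  have hfrac : ∀ n, fracModular g s (fun x => Z x - χ n x) ≤
      K * (ENNReal.ofReal ((1 / 2) ^ n) + ENNReal.ofReal ((1 / 2) ^ n)) := fun n => by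
    rw [hrw]
    exact (fracModular_sub_le hg (hum.sub (hφ n).aemeasurable)).trans
      (by gcongr; exacts [hφ2 n, hψ2 n])
  have hsum := tsum_ofReal_half_pow_ne_top hK
  have hto := ENNReal.tendsto_atTop_zero_of_tsum_ne_top hsum
  have hae : ∀ᵐ x, Tendsto (fun n => Z x - χ n x) atTop (𝓝 0) := by
    refine hg.diagFamily.ae_tendsto_zero (fun _ => one_pos) (fun n => hZm.sub (hχm n))
      (ne_top_of_le_ne_top hsum (ENNReal.tsum_le_tsum fun n => ?_))
    rw [← modular_eq_familyModular]
    exact hmod n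
  have haeW : ∀ᵐ x, Tendsto (fun n => W x - B n x) atTop (𝓝 0) := by
    filter_upwards [hae] with x hx
    have h1 : Tendsto (fun n => |Z x - χ n x| + e n) atTop (𝓝 0) := by
      simpa [e] using hx.abs.add tendsto_one_div_add_atTop_nhds_zero_nat
    refine squeeze_zero_norm (fun n => ?_) h1
    have h2 := abs_max_zero_sub_le (Z x) (χ n x)
    have h3 := abs_smoothPos_sub_max_le (he n) (χ n x)
    rw [abs_sub_comm] at h3
    exact (abs_sub_le _ (max (χ n x) 0) _).trans (add_le_add h2 h3)
  -- Convergence of the quotients is inherited from that of the functions at both points, so the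
  -- pair weight, which may vanish, need not be positive.
  have haeD : ∀ᵐ p : EuclideanSpace ℝ (Fin d) × EuclideanSpace ℝ (Fin d),
      Tendsto (fun n => diffQuot s W p.1 p.2 - diffQuot s (B n) p.1 p.2) atTop (𝓝 0) := by
    filter_upwards [Measure.quasiMeasurePreserving_fst.ae haeW,
      Measure.quasiMeasurePreserving_snd.ae haeW] with p h1 h2
    have h3 := (h1.sub h2).div_const (‖p.1 - p.2‖ ^ s)
    rw [sub_zero, zero_div] at h3
    refine h3.congr fun n => ?_
    simp only [diffQuot]; ring
  have hZmod : modular g Z ≠ ∞ := ne_top_of_le_ne_top (ENNReal.mul_ne_top hK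
    (ENNReal.add_ne_top.2 ⟨hu.memW.modular_lt_top.ne, hv.memW.modular_lt_top.ne⟩))
    (modular_sub_le hg hum)
  have hZfrac : fracModular g s Z ≠ ∞ := ne_top_of_le_ne_top (ENNReal.mul_ne_top hK
    (ENNReal.add_ne_top.2 ⟨hu.memW.fracModular_lt_top.ne, hv.memW.fracModular_lt_top.ne⟩))
    (fracModular_sub_le hg hum)
  have htmod := tendsto_of_tendsto_of_tendsto_of_le_of_le tendsto_const_nhds hto
    (fun _ => zero_le) hmod
  have htfrac := tendsto_of_tendsto_of_tendsto_of_le_of_le tendsto_const_nhds hto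
    (fun _ => zero_le) hfrac
  simp only [modular_eq_familyModular] at htmod hZmod
  simp only [fracModular_eq_familyModular, diffQuot_sub] at htfrac hZfrac
  -- The bound `ε / 2` leaves room for the two Luxemburg terms of the norm; `t ≤ 1` makes the
  -- scaling factor `t⁻¹` at least `1`, as doubling requires.
  obtain ⟨t, ht0, ht⟩ : ∃ t : ℝ≥0, 0 < t ∧ (t : ℝ≥0∞) < min (ε / 2) 1 := by
    obtain ⟨t, h1, h2⟩ := ENNReal.lt_iff_exists_nnreal_btwn.1
      (lt_min (ENNReal.half_pos hε.ne') one_pos : (0 : ℝ≥0∞) < min (ε / 2) 1)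
    exact ⟨t, by exact_mod_cast h1, h2⟩
  have ht0' : (0 : ℝ) < t := ht0
  have ht1 : (t : ℝ) ≤ 1 := by exact_mod_cast (ht.trans_le (min_le_right _ _)).le
  have hc : 1 ≤ (t : ℝ)⁻¹ := (one_le_inv₀ ht0').2 ht1
  have hev1 := hg.diagFamily.eventually_familyModular_le_one hc hZm hWm hχm hBm
    (fun x => by simpa using abs_max_zero_sub_le (Z x) 0)
    (fun n x => by simpa [B, smoothPos_zero (he n)] using abs_smoothPos_sub_le (e n) (χ n x) 0)
    hZmod htmod haeW
  have hev2 := hg.pairFamily.eventually_familyModular_le_one hc (aemeasurable_diffQuot s hZm)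
    (aemeasurable_diffQuot s hWm) (fun n => aemeasurable_diffQuot s (hχm n))
    (fun n => aemeasurable_diffQuot s (hBm n))
    (fun p => abs_diffQuot_le s (abs_max_zero_sub_le (Z p.1) (Z p.2)))
    (fun n p => abs_diffQuot_le s (abs_smoothPos_sub_le (e n) (χ n p.1) (χ n p.2)))
    hZfrac htfrac haeD
  obtain ⟨n, hn1, hn2⟩ := (hev1.and hev2).exists
  refine ⟨B n, hBt n, ?_⟩
  have l1 : luxemburg (modular g) (fun x => W x - B n x) ≤ ENNReal.ofReal t := by
    refine luxemburg_le_ofReal ht0' ?_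
    rw [modular_eq_familyModular]
    exact hn1 _ fun x => by rw [div_eq_inv_mul]
  have l2 : luxemburg (fracModular g s) (fun x => W x - B n x) ≤ ENNReal.ofReal t := by
    refine luxemburg_le_ofReal ht0' ?_
    rw [fracModular_eq_familyModular]
    exact hn2 _ fun p => by
      rw [← diffQuot_sub]
      exact diffQuot_mul s _ _ _ (fun x => by rw [div_eq_inv_mul]) _ _
  rw [ENNReal.ofReal_coe_nnreal] at l1 l2
  have ht2 := ht.trans_le (min_le_left _ _)
  calc normW g s (fun x => W x - B n x) ≤ t + t := add_le_add l1 l2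
    _ < ε / 2 + ε / 2 := ENNReal.add_lt_add ht2 ht2
    _ = ε := ENNReal.add_halves ε

end FracOrlicz
-- Monotonicity of the operator and the comparison argument.
namespace FracOrlicz

theorem MemW.integrable_operatorPairing {d : ℕ} {gl gu s : ℝ}
    {g : EuclideanSpace ℝ (Fin d) → EuclideanSpace ℝ (Fin d) → ℝ → ℝ}
    {u v : EuclideanSpace ℝ (Fin d) → ℝ} (hg : IsNonlinearity gl gu g) (hu : MemW g s u)
    (hv : MemW g s v) :
    Integrable (fun p : EuclideanSpace ℝ (Fin d) × EuclideanSpace ℝ (Fin d) =>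
      g p.1 p.2 |diffQuot s u p.1 p.2| * diffQuot s u p.1 p.2 * diffQuot s v p.1 p.2
        / ‖p.1 - p.2‖ ^ d) :=
  hg.pairFamily.integrable_field_mul (aemeasurable_diffQuot s hu.aemeasurable)
    (aemeasurable_diffQuot s hv.aemeasurable) hu.fracModular_lt_top.ne hv.fracModular_lt_top.ne

/-- The sign of the increments of `(u' - u)⁺` agrees with that of the increments of `u' - u`. -/
theorem IsProfile.field_mul_posPart_le {gl gu c k : ℝ} {h : ℝ → ℝ} (H : IsProfile gl gu h)
    (hgl : 0 < gl) (hc : 0 ≤ c) (hk : 0 ≤ k) (a b a' b' : ℝ) :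
    h |(a - b) / c| * ((a - b) / c) * ((max (a' - a) 0 - max (b' - b) 0) / c) / k ≤
      h |(a' - b') / c| * ((a' - b') / c) * ((max (a' - a) 0 - max (b' - b) 0) / c) / k := by
  refine div_le_div_of_nonneg_right ?_ hk
  have hm := (H.strictMono_field hgl).monotone
  rcases le_total (b' - b) (a' - a) with h1 | h1
  · have h2 := hm (show (a - b) / c ≤ (a' - b') / c from
      div_le_div_of_nonneg_right (by linarith) hc)
    exact mul_le_mul_of_nonneg_right h2
      (div_nonneg (sub_nonneg.2 (max_le_max_right 0 h1)) hc)
  · have h2 := hm (show (a' - b') / c ≤ (a - b) / c from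
      div_le_div_of_nonneg_right (by linarith) hc)
    exact mul_le_mul_of_nonpos_right h2
      (div_nonpos_of_nonpos_of_nonneg (sub_nonpos.2 (max_le_max_right 0 h1)) hc)

/-- The equality case: either the increment of the positive part is zero, or the fields coincide,
and injectivity makes the increments of both functions equal. -/
theorem IsProfile.posPart_eq_of_field_mul_eq {gl gu c k : ℝ} {h : ℝ → ℝ} (H : IsProfile gl gu h)
    (hgl : 0 < gl) (hc : 0 < c) (hk : 0 < k) {a b a' b' : ℝ}
    (e : h |(a - b) / c| * ((a - b) / c) * ((max (a' - a) 0 - max (b' - b) 0) / c) / k =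
      h |(a' - b') / c| * ((a' - b') / c) * ((max (a' - a) 0 - max (b' - b) 0) / c) / k) :
    max (a' - a) 0 = max (b' - b) 0 := by
  rw [div_left_inj' hk.ne'] at e
  rcases mul_eq_mul_right_iff.1 e with h1 | h1
  · have h2 := (H.strictMono_field hgl).injective h1
    rw [div_left_inj' hc.ne'] at h2
    rw [show a' - a = b' - b by linarith]
  · rcases div_eq_zero_iff.1 h1 with h2 | h2
    · linarith
    · exact absurd h2 hc.ne'

theorem ae_eq_zero_of_ae_prod_eq {d : ℕ} (hd : 1 ≤ d) {Ω : Set (EuclideanSpace ℝ (Fin d))}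
    (hΩ : Bornology.IsBounded Ω) {w : EuclideanSpace ℝ (Fin d) → ℝ}
    (hw0 : ∀ᵐ x, x ∉ Ω → w x = 0)
    (hw : ∀ᵐ p : EuclideanSpace ℝ (Fin d) × EuclideanSpace ℝ (Fin d), w p.1 = w p.2) :
    ∀ᵐ x, w x = 0 := by
  -- Positive dimension makes the space noncompact, so its volume is infinite and a bounded `Ω`
  -- cannot have full measure.
  have : Nonempty (Fin d) := ⟨⟨0, hd⟩⟩
  have h1 : ∀ᵐ y, ∀ᵐ x, w y = w x := Measure.ae_ae_of_ae_prod hw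
  obtain ⟨y, hyΩ, hy0, hy⟩ : ∃ y, y ∉ Ω ∧ (y ∉ Ω → w y = 0) ∧ ∀ᵐ x, w y = w x := by
    by_contra hc
    have h2 : ∀ᵐ y, y ∈ Ω := by
      filter_upwards [h1, hw0] with y hy1 hy2
      by_contra hyΩ
      exact hc ⟨y, hyΩ, hy2, hy1⟩
    have h3 : (volume : Measure (EuclideanSpace ℝ (Fin d))) univ ≤ volume Ω :=
      measure_mono_ae (by filter_upwards [h2] with y hy _ using hy)
    rw [measure_univ_of_isAddLeftInvariant] at h3
    exact absurd h3 (not_le.2 hΩ.measure_lt_top)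
  filter_upwards [hy] with x hx
  rw [← hx, hy0 hyΩ]

end FracOrlicz

theorem mainTheorem6 {d : ℕ} (hd : 1 ≤ d) (s : ℝ) (hs0 : 0 < s) (hs1 : s < 1)
    (Ω : Set (EuclideanSpace ℝ (Fin d))) (hΩo : IsOpen Ω) (hΩb : Bornology.IsBounded Ω)
    (gl gu : ℝ) (g : EuclideanSpace ℝ (Fin d) → EuclideanSpace ℝ (Fin d) → ℝ → ℝ)
    (hg : FracOrlicz.IsNonlinearity gl gu g)
    (F F' : (EuclideanSpace ℝ (Fin d) → ℝ) → ℝ)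
    (hF : FracOrlicz.IsDual g s Ω F) (hF' : FracOrlicz.IsDual g s Ω F')
    (u u' : EuclideanSpace ℝ (Fin d) → ℝ)
    (hu : FracOrlicz.IsSolution g s Ω F u) (hu' : FracOrlicz.IsSolution g s Ω F' u')
    (hle : FracOrlicz.DualLE g s Ω F' F) :
    ∀ᵐ x ∂(MeasureTheory.volume.restrict Ω), u' x ≤ u x := by
  have hw := hu'.memW0.posPart_sub hg hu.memW0
  have hI := hu.memW0.memW.integrable_operatorPairing hg hw.memW
  have hI' := hu'.memW0.memW.integrable_operatorPairing hg hw.memW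
  have hsign := hle _ hw (Eventually.of_forall fun x => le_max_right _ _)
  rw [← hu.eq _ hw, ← hu'.eq _ hw] at hsign
  have hmono := hg.profile.mono fun p hp => hp.field_mul_posPart_le hg.gl_pos
    (Real.rpow_nonneg (norm_nonneg (p.1 - p.2)) s) (pow_nonneg (norm_nonneg (p.1 - p.2)) d)
    (u p.1) (u p.2) (u' p.1) (u' p.2)
  -- The data order and monotonicity give opposite inequalities between the two pairings; ordered
  -- integrands with equal integrals agree almost everywhere.
  have heq := (integral_eq_iff_of_ae_le hI hI' hmono).1
    (le_antisymm (integral_mono_ae hI hI' hmono) (sub_nonneg.1 hsign))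
  have hconst : ∀ᵐ p : EuclideanSpace ℝ (Fin d) × EuclideanSpace ℝ (Fin d),
      max (u' p.1 - u p.1) 0 = max (u' p.2 - u p.2) 0 := by
    filter_upwards [heq, hg.profile] with p hp hprof
    rcases eq_or_ne p.1 p.2 with e | e
    · rw [e]
    · have h0 : 0 < ‖p.1 - p.2‖ := norm_pos_iff.2 (sub_ne_zero.2 e)
      exact hprof.posPart_eq_of_field_mul_eq hg.gl_pos (Real.rpow_pos_of_pos h0 s)
        (pow_pos h0 d) hp
  refine ae_restrict_of_ae ?_
  filter_upwards [FracOrlicz.ae_eq_zero_of_ae_prod_eq hd hΩb hw.ae_zero hconst] with x hx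
  exact sub_nonpos.1 (max_eq_right_iff.1 hx)
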